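/- Theorem (Thm: Foster Interpretation). Let $G$ be a finite connected multigraph (loops and parallel edges allowed) with nonempty vertex set $V$, edge set $E$, a fixed orientation $e\mapsto(e^-,e^+)$ of its edges, and a length $\ell(e)>0$ for each edge $e$. Give $C_1(G,\mathbb R)=\mathbb R^{E}$ the inner product $\langle\alpha,\beta\rangle=\sum_{e}\alpha(e)\beta(e)\ell(e)$. Let $d:\mathbb R^V\to C_1(G,\mathbb R)$, $(df)(e)=(f(e^+)-f(e^-))/\ell(e)$, let $d^*:C_1(G,\mathbb R)\to\mathbb R^V$, $(d^*\alpha)(x)=\sum_{e^+=x}\alpha(e)-\sum_{e^-=x}\alpha(e)$, be its adjoint, and let $\pi$ be the orthogonal projection of $C_1(G,\mathbb R)$ onto $H_1(G,\mathbb R)=\ker d^*$. The Foster coefficient of an edge $e$, regarded as a $1$-chain, is $F(e)=\|\pi(e)\|_{\sup}=\max_{e'\in E}|\pi(e)(e')|$. The effective resistance between vertices $x,y$ of a finite connected graph, each edge $e$ being a wire of resistance $\ell(e)$, is $f(x)-f(y)$ for any $f:V\to\mathbb R$ with $d^*df=\delta_x-\delta_y$ (such an $f$ exists and is unique up to an additive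 constant). Let $r(e)$ be the effective resistance between $e^-$ and $e^+$ in $G$, and let $\mathcal R(e)$ be the effective resistance between $e^-$ and $e^+$ in the graph $G-e$ obtained by deleting the edge $e$, with $\mathcal R(e)=\infty$ if $G-e$ is disconnected. Then for every edge $e$ of $G$, $$F(e)=1-\frac{r(e)}{\ell(e)}=\frac{\ell(e)}{\ell(e)+\mathcal R(e)},$$ where the last quantity is interpreted as $0$ if $\mathcal R(e)=\infty$. -/

import Mathlib

/-- A multigraph (loops and parallel edges allowed) with vertex set `V` and edge set `E`, endowed
with an orientation of its edges and a positive length for each edge. Connectedness is the separate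
predicate `LengthGraph.Connected`, because deleting an edge may destroy it. -/
structure LengthGraph (V : Type*) (E : Type*) where
  /-- The tail vertex of an edge. -/
  tail : E → V
  /-- The head vertex of an edge. -/
  head : E → V
  /-- The length of an edge. -/
  len : E → ℝ
  len_pos : ∀ e, 0 < len e

namespace LengthGraph

section Basic

variable {V E : Type*}

/-- Two vertices are adjacent if some edge has them as its endpoints, in either order. -/
def Adj (G : LengthGraph V E) (x y : V) : Prop :=
  ∃ e, (G.tail e = x ∧ G.head e = y) ∨ (G.tail e = y ∧ G.head e = x)

/-- The vertex set is nonempty, and any two vertices are joined by a path. -/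
def Connected (G : LengthGraph V E) : Prop :=
  Nonempty V ∧ ∀ x y, Relation.ReflTransGen G.Adj x y

/-- The graph `G - e`, obtained by deleting the edge `e` and keeping all vertices. -/
def deleteEdge (G : LengthGraph V E) (e : E) : LengthGraph V {f : E // f ≠ e} where
  tail f := G.tail f
  head f := G.head f
  len f := G.len f
  len_pos f := G.len_pos f

/-- The space `C_1(G, ℝ)` of real `1`-chains, identified with the real functions on the edge set.
It depends on `G` because its inner product does. -/
def Chain (_G : LengthGraph V E) : Type _ := E → ℝ

noncomputable instance (G : LengthGraph V E) : AddCommGroup G.Chain :=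
  inferInstanceAs (AddCommGroup (E → ℝ))

noncomputable instance (G : LengthGraph V E) : Module ℝ G.Chain :=
  inferInstanceAs (Module ℝ (E → ℝ))

instance (G : LengthGraph V E) [Fintype E] : FiniteDimensional ℝ G.Chain :=
  inferInstanceAs (FiniteDimensional ℝ (E → ℝ))

/-- The coefficient of the edge `e` in a `1`-chain. -/
def Chain.coeff {G : LengthGraph V E} (α : G.Chain) (e : E) : ℝ := (α : E → ℝ) e

/-- The `1`-chain with given coefficients. -/
def mkChain (G : LengthGraph V E) (a : E → ℝ) : G.Chain := a

theorem coeff_mkChain {G : LengthGraph V E} (a : E → ℝ) (e : E) : (G.mkChain a).coeff e = a e :=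
  rfl

theorem chain_ext {G : LengthGraph V E} {α β : G.Chain} (h : ∀ e, α.coeff e = β.coeff e) :
    α = β :=
  funext h

theorem coeff_add {G : LengthGraph V E} (α β : G.Chain) (e : E) :
    (α + β).coeff e = α.coeff e + β.coeff e := rfl

theorem coeff_smul {G : LengthGraph V E} (r : ℝ) (α : G.Chain) (e : E) :
    (r • α).coeff e = r * α.coeff e := rfl

theorem coeff_zero {G : LengthGraph V E} (e : E) : (0 : G.Chain).coeff e = 0 := rfl

/-- The inner product `⟨α, β⟩ = ∑ e, α(e) * β(e) * len e` on `C_1(G, ℝ)`. -/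
@[reducible]
noncomputable def chainCore (G : LengthGraph V E) [Fintype E] :
    InnerProductSpace.Core ℝ G.Chain where
  inner α β := ∑ e, α.coeff e * β.coeff e * G.len e
  conj_inner_symm α β := by
    simp only [conj_trivial]
    exact Finset.sum_congr rfl fun e _ => by ring
  re_inner_nonneg α := by
    simp only [RCLike.re_to_real]
    exact Finset.sum_nonneg fun e _ => mul_nonneg (mul_self_nonneg _) (G.len_pos e).le
  add_left α β γ := by
    rw [← Finset.sum_add_distrib]
    refine Finset.sum_congr rfl fun e _ => ?_
    rw [coeff_add]
    ring
  smul_left α β r := by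
    rw [Finset.mul_sum]
    refine Finset.sum_congr rfl fun e _ => ?_
    rw [coeff_smul]
    simp only [conj_trivial]
    ring
  definite α h := by
    have h' := (Finset.sum_eq_zero_iff_of_nonneg
      (fun e _ => mul_nonneg (mul_self_nonneg (α.coeff e)) (G.len_pos e).le)).1 h
    refine chain_ext fun e => ?_
    rcases mul_eq_zero.1 (h' e (Finset.mem_univ e)) with h1 | h1
    · exact mul_self_eq_zero.1 h1
    · exact absurd h1 (G.len_pos e).ne'

noncomputable instance (G : LengthGraph V E) [Fintype E] : NormedAddCommGroup G.Chain :=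
  G.chainCore.toNormedAddCommGroup

noncomputable instance (G : LengthGraph V E) [Fintype E] : InnerProductSpace ℝ G.Chain :=
  InnerProductSpace.ofCore G.chainCore.toCore

theorem chain_inner (G : LengthGraph V E) [Fintype E] (α β : G.Chain) :
    inner ℝ α β = ∑ e, α.coeff e * β.coeff e * G.len e := rfl

/-- The slope operator `d : C_0(G, ℝ) → C_1(G, ℝ)`, `(d f)(e) = (f(e⁺) - f(e⁻)) / len e`. -/
noncomputable def d (G : LengthGraph V E) : (V → ℝ) →ₗ[ℝ] G.Chain where
  toFun f := G.mkChain fun e => (f (G.head e) - f (G.tail e)) / G.len e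
  map_add' f g := chain_ext fun e => by
    simp only [coeff_add, coeff_mkChain, Pi.add_apply]
    ring
  map_smul' r f := chain_ext fun e => by
    simp only [coeff_smul, coeff_mkChain, Pi.smul_apply, smul_eq_mul, RingHom.id_apply]
    ring

theorem d_apply (G : LengthGraph V E) (f : V → ℝ) (e : E) :
    (G.d f).coeff e = (f (G.head e) - f (G.tail e)) / G.len e := rfl

/-- The operator `d* : C_1(G, ℝ) → C_0(G, ℝ)`,
`(d* α)(x) = ∑_{e⁺ = x} α(e) - ∑_{e⁻ = x} α(e)`. -/
noncomputable def dStar (G : LengthGraph V E) [Fintype E] [DecidableEq V] :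
    G.Chain →ₗ[ℝ] (V → ℝ) where
  toFun α := fun x =>
    (∑ e with G.head e = x, α.coeff e) - ∑ e with G.tail e = x, α.coeff e
  map_add' α β := by
    funext x
    simp only [coeff_add, Finset.sum_add_distrib, Pi.add_apply]
    ring
  map_smul' r α := by
    funext x
    simp only [coeff_smul, ← Finset.mul_sum, Pi.smul_apply, smul_eq_mul, RingHom.id_apply]
    ring

theorem dStar_apply (G : LengthGraph V E) [Fintype E] [DecidableEq V] (α : G.Chain) (x : V) :
    G.dStar α x = (∑ e with G.head e = x, α.coeff e) - ∑ e with G.tail e = x, α.coeff e := rfl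

/-- `d*` is the adjoint of `d`. -/
theorem inner_d (G : LengthGraph V E) [Fintype V] [Fintype E] [DecidableEq V]
    (f : V → ℝ) (α : G.Chain) : inner ℝ (G.d f) α = ∑ x, f x * G.dStar α x := by
  have h1 : ∀ p : E → V, ∑ x, f x * ∑ e with p e = x, α.coeff e = ∑ e, f (p e) * α.coeff e := by
    intro p
    rw [← Finset.sum_fiberwise Finset.univ p (fun e => f (p e) * α.coeff e)]
    refine Finset.sum_congr rfl fun x _ => ?_
    rw [Finset.mul_sum]
    refine Finset.sum_congr rfl fun e he => ?_
    rw [(Finset.mem_filter.1 he).2]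
  have h2 : ∑ x, f x * G.dStar α x =
      ∑ x, f x * (∑ e with G.head e = x, α.coeff e) - ∑ x, f x * ∑ e with G.tail e = x, α.coeff e := by
    rw [← Finset.sum_sub_distrib]
    exact Finset.sum_congr rfl fun x _ => mul_sub _ _ _
  rw [h2, h1, h1, ← Finset.sum_sub_distrib, chain_inner]
  refine Finset.sum_congr rfl fun e _ => ?_
  rw [d_apply]
  have := (G.len_pos e).ne'
  field_simp

/-- The space `H_1(G, ℝ) = ker d*` of real `1`-cycles. -/
noncomputable def H1 (G : LengthGraph V E) [Fintype E] [DecidableEq V] : Submodule ℝ G.Chain :=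
  LinearMap.ker G.dStar

/-- The orthogonal projection of `C_1(G, ℝ)` onto `H_1(G, ℝ)`. -/
noncomputable def proj (G : LengthGraph V E) [Fintype E] [DecidableEq V] :
    G.Chain →L[ℝ] G.Chain :=
  G.H1.starProjection

/-- The supremum norm of a `1`-chain. -/
noncomputable def supNorm (G : LengthGraph V E) (α : G.Chain) : ℝ := ⨆ j : E, |α.coeff j|

/-- An edge, as a `1`-chain. -/
def edgeChain (G : LengthGraph V E) [DecidableEq E] (e : E) : G.Chain :=
  G.mkChain fun j => if j = e then 1 else 0

/-- The Foster coefficient `F(e) = ‖π(e)‖_sup`. -/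
noncomputable def foster (G : LengthGraph V E) [Fintype E] [DecidableEq V] [DecidableEq E]
    (e : E) : ℝ :=
  G.supNorm (G.proj (G.edgeChain e))

/-- The weighted Laplacian `Δ = d* d`. -/
noncomputable def laplacian (G : LengthGraph V E) [Fintype E] [DecidableEq V] :
    (V → ℝ) →ₗ[ℝ] (V → ℝ) :=
  G.dStar ∘ₗ G.d

/-- `f` is a potential (voltage function) on the vertices when one unit of current enters the
network at `x` and leaves it at `y`, an edge being a wire of resistance its length. -/
def IsPotential (G : LengthGraph V E) [Fintype E] [DecidableEq V] (x y : V) (f : V → ℝ) : Prop :=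
  G.laplacian f = Pi.single x 1 - Pi.single y 1

theorem eq_of_d_eq_zero (G : LengthGraph V E) (hG : G.Connected) {f : V → ℝ} (hf : G.d f = 0)
    (x y : V) : f x = f y := by
  have step : ∀ e, f (G.head e) = f (G.tail e) := by
    intro e
    have h : (f (G.head e) - f (G.tail e)) / G.len e = 0 := by
      rw [← d_apply, hf, coeff_zero]
    rcases div_eq_zero_iff.1 h with h | h
    · linarith
    · exact absurd h (G.len_pos e).ne'
  induction hG.2 x y with
  | refl => rfl
  | tail _ hbc ih =>
    obtain ⟨e, ⟨rfl, rfl⟩ | ⟨rfl, rfl⟩⟩ := hbc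
    · exact ih.trans (step e).symm
    · exact ih.trans (step e)

theorem d_eq_zero_of_laplacian_eq_zero (G : LengthGraph V E) [Fintype V] [Fintype E]
    [DecidableEq V] {f : V → ℝ} (hf : G.laplacian f = 0) : G.d f = 0 := by
  have h : inner ℝ (G.d f) (G.d f) = 0 := by
    rw [inner_d]
    refine Finset.sum_eq_zero fun x _ => ?_
    have : G.dStar (G.d f) x = 0 := congrFun hf x
    rw [this, mul_zero]
  exact inner_self_eq_zero.1 h

/-- On a connected finite graph the potential exists. -/
theorem exists_isPotential (G : LengthGraph V E) [Fintype V] [Fintype E] [DecidableEq V]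
    (hG : G.Connected) (x y : V) : ∃ f, G.IsPotential x y f := by
  obtain ⟨v⟩ := hG.1
  let s : (V → ℝ) →ₗ[ℝ] ℝ := ∑ z, LinearMap.proj z
  have hs : ∀ g : V → ℝ, s g = ∑ z, g z := fun g => by simp [s]
  let L : (V → ℝ) →ₗ[ℝ] (V → ℝ) := G.laplacian + (LinearMap.toSpanSingleton ℝ (V → ℝ) 1) ∘ₗ s
  have hL : ∀ g, L g = G.laplacian g + s g • (1 : V → ℝ) := fun g => rfl
  have hsum : ∀ g, ∑ z, G.laplacian g z = 0 := by
    intro g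
    have h := G.inner_d (1 : V → ℝ) (G.d g)
    have h0 : G.d (1 : V → ℝ) = 0 := by
      refine chain_ext fun e => ?_
      rw [d_apply, coeff_zero]
      simp
    rw [h0, inner_zero_left] at h
    simpa [laplacian] using h.symm
  have hcard : (0 : ℝ) < Fintype.card V := by
    have : Nonempty V := ⟨v⟩
    exact_mod_cast Fintype.card_pos
  have hsL : ∀ g, ∑ z, L g z = s g * Fintype.card V := by
    intro g
    simp only [hL, Pi.add_apply, Finset.sum_add_distrib, hsum, zero_add, Pi.smul_apply,
      Pi.one_apply, smul_eq_mul, mul_one, Finset.sum_const, Finset.card_univ, nsmul_eq_mul]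
    ring
  have inj : Function.Injective L := by
    rw [← LinearMap.ker_eq_bot, LinearMap.ker_eq_bot']
    intro g hg
    have h1 : s g = 0 := by
      have := hsL g
      rw [hg] at this
      simp only [Pi.zero_apply, Finset.sum_const_zero] at this
      rcases mul_eq_zero.1 this.symm with h | h
      · exact h
      · exact absurd h hcard.ne'
    have h2 : G.laplacian g = 0 := by
      rw [hL, h1, zero_smul, add_zero] at hg
      exact hg
    have h3 := G.eq_of_d_eq_zero hG (G.d_eq_zero_of_laplacian_eq_zero h2)
    funext z
    rw [hs, Finset.sum_congr rfl fun w _ => h3 w z] at h1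
    simp only [Finset.sum_const, Finset.card_univ, nsmul_eq_mul] at h1
    rcases mul_eq_zero.1 h1 with h | h
    · exact absurd h hcard.ne'
    · exact h
  obtain ⟨f, hf⟩ := LinearMap.injective_iff_surjective.1 inj (Pi.single x 1 - Pi.single y 1)
  refine ⟨f, ?_⟩
  have h1 : s f = 0 := by
    have h := hsL f
    rw [hf] at h
    simp only [Pi.sub_apply, Finset.sum_sub_distrib, Finset.sum_pi_single', Finset.mem_univ,
      if_true, sub_self] at h
    rcases mul_eq_zero.1 h.symm with h | h
    · exact h
    · exact absurd h hcard.ne'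
  rw [hL, h1, zero_smul, add_zero] at hf
  exact hf

/-- On a connected finite graph the potential is unique up to an additive constant, so that its
difference between two vertices is well defined. -/
theorem IsPotential.sub_eq {G : LengthGraph V E} [Fintype V] [Fintype E] [DecidableEq V]
    (hG : G.Connected) {x y : V} {f g : V → ℝ} (hf : G.IsPotential x y f)
    (hg : G.IsPotential x y g) : f x - f y = g x - g y := by
  have h : G.laplacian (f - g) = 0 := by
    rw [map_sub, hf, hg, sub_self]
  have := G.eq_of_d_eq_zero hG (G.d_eq_zero_of_laplacian_eq_zero h) x y
  simp only [Pi.sub_apply] at this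
  linarith

open Classical in
/-- The effective resistance between `x` and `y`: the potential difference `f x - f y` when one unit
of current enters at `x` and leaves at `y`. It is used for connected graphs only, where such an `f`
exists and the difference does not depend on the choice of `f`; otherwise it is `0` by default. -/
noncomputable def effRes (G : LengthGraph V E) [Fintype E] [DecidableEq V] (x y : V) : ℝ :=
  if h : ∃ f, G.IsPotential x y f then h.choose x - h.choose y else 0

theorem effRes_eq (G : LengthGraph V E) [Fintype V] [Fintype E] [DecidableEq V]
    (hG : G.Connected) {x y : V} {f : V → ℝ} (hf : G.IsPotential x y f) :
    G.effRes x y = f x - f y := by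
  have h : ∃ f, G.IsPotential x y f := ⟨f, hf⟩
  rw [effRes, dif_pos h]
  exact IsPotential.sub_eq hG h.choose_spec hf

/-- `r(e)`, the effective resistance in `G` between the endpoints of the edge `e`. -/
noncomputable def edgeRes (G : LengthGraph V E) [Fintype E] [DecidableEq V] (e : E) : ℝ :=
  G.effRes (G.tail e) (G.head e)

open Classical in
/-- `𝓡(e)`, the effective resistance between the endpoints of `e` in `G - e` if that graph is
connected, and `∞` otherwise. -/
noncomputable def edgeDelRes (G : LengthGraph V E) [Fintype E] [DecidableEq V] [DecidableEq E]
    (e : E) : EReal :=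
  if (G.deleteEdge e).Connected then
    (((G.deleteEdge e).effRes (G.tail e) (G.head e) : ℝ) : EReal)
  else ⊤

end Basic

end LengthGraph

namespace LengthGraph

/-! Let `f` be a potential for a unit current from `e⁻` to `e⁺`. The boundary of `d f` cancels that
of `e`, and `d f` is orthogonal to all cycles, so `π(e) = e + d f` (`proj_edgeChain`). Its
coefficient at `e` is therefore `1 - r(e)/ℓ(e)`.

This coefficient is the maximum (`abs_coeff_proj_edgeChain_le`). Off `e` the cycle runs up the
gradient of `f`, so every edge other than `e` crosses a superlevel set of `f` in the same direction.
The total flow through that cut is zero, hence `e` alone returns what all the others carry.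

If `G - e` is connected, a rescaled potential of `G - e` is one of `G`, which is the parallel law
for `ℓ(e)` and `𝓡(e)`. If not, `e` is a bridge and no cycle uses it. -/

/-! ### Projection of an edge onto the cycle space -/

theorem dStar_edgeChain {V E : Type*} [Fintype E] [DecidableEq V] [DecidableEq E]
    (G : LengthGraph V E) (e : E) :
    G.dStar (G.edgeChain e) = Pi.single (G.head e) 1 - Pi.single (G.tail e) 1 := by
  funext x
  simp only [dStar_apply, edgeChain, coeff_mkChain, Finset.sum_ite_eq', Finset.mem_filter,
    Finset.mem_univ, true_and, Pi.sub_apply, Pi.single_apply, eq_comm (a := x)]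

/-- The projection of an edge onto the cycle space, in terms of a potential. -/
theorem proj_edgeChain {V E : Type*} [Fintype V] [Fintype E] [DecidableEq V] [DecidableEq E]
    (G : LengthGraph V E) (e : E) {f : V → ℝ}
    (hf : G.IsPotential (G.tail e) (G.head e) f) :
    G.proj (G.edgeChain e) = G.edgeChain e + G.d f := by
  refine Submodule.eq_starProjection_of_mem_of_inner_eq_zero ?_ fun w hw => ?_
  · have h : G.dStar (G.d f) = Pi.single (G.tail e) 1 - Pi.single (G.head e) 1 := hf
    rw [H1, LinearMap.mem_ker, map_add, dStar_edgeChain, h]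
    abel
  · have h : G.dStar w = 0 := hw
    rw [sub_add_cancel_left, inner_neg_left, inner_d, h]
    simp

theorem coeff_proj_edgeChain {V E : Type*} [Fintype V] [Fintype E] [DecidableEq V] [DecidableEq E]
    (G : LengthGraph V E) (e : E) {f : V → ℝ}
    (hf : G.IsPotential (G.tail e) (G.head e) f) (j : E) :
    (G.proj (G.edgeChain e)).coeff j =
      (if j = e then 1 else 0) + (f (G.head j) - f (G.tail j)) / G.len j := by
  rw [G.proj_edgeChain e hf]
  rfl

/-- A cycle is orthogonal to every coboundary. -/
theorem sum_sub_mul_coeff_proj {V E : Type*} [Fintype V] [Fintype E] [DecidableEq V]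
    (G : LengthGraph V E) (α : G.Chain) (g : V → ℝ) :
    ∑ j, (g (G.head j) - g (G.tail j)) * (G.proj α).coeff j = 0 := by
  have hp : G.dStar (G.proj α) = 0 := G.H1.starProjection_apply_mem α
  have h := G.inner_d g (G.proj α)
  rw [hp, chain_inner] at h
  simp only [Pi.zero_apply, mul_zero, Finset.sum_const_zero] at h
  rw [← h]
  refine Finset.sum_congr rfl fun j _ => ?_
  rw [d_apply]
  have := (G.len_pos j).ne'
  field_simp

theorem inner_edgeChain {V E : Type*} [Fintype E] [DecidableEq E]
    (G : LengthGraph V E) (e : E) (α : G.Chain) :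
    inner ℝ (G.edgeChain e) α = α.coeff e * G.len e := by
  rw [chain_inner]
  simp [edgeChain, coeff_mkChain]

/-- Pairing `e` with `π(e)` gives `‖π(e)‖² = π(e)(e) * ℓ(e)`. -/
theorem coeff_proj_edgeChain_self_nonneg {V E : Type*} [Fintype E] [DecidableEq V] [DecidableEq E]
    (G : LengthGraph V E) (e : E) :
    0 ≤ (G.proj (G.edgeChain e)).coeff e := by
  have h : inner ℝ (G.edgeChain e - G.proj (G.edgeChain e)) (G.proj (G.edgeChain e)) = 0 :=
    Submodule.starProjection_inner_eq_zero _ _ (G.H1.starProjection_apply_mem _)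
  rw [inner_sub_left, sub_eq_zero, inner_edgeChain] at h
  exact nonneg_of_mul_nonneg_left (h ▸ real_inner_self_nonneg) (G.len_pos e)

/-- No edge carries more of the cycle `π(e)` than `e` itself. -/
theorem abs_coeff_proj_edgeChain_le {V E : Type*}
    [Fintype V] [Fintype E] [DecidableEq V] [DecidableEq E]
    (G : LengthGraph V E) (hG : G.Connected) (e j : E) :
    |(G.proj (G.edgeChain e)).coeff j| ≤ (G.proj (G.edgeChain e)).coeff e := by
  obtain ⟨f, hf⟩ := G.exists_isPotential hG (G.tail e) (G.head e)
  have hp0 := G.coeff_proj_edgeChain_self_nonneg e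
  rcases eq_or_ne j e with rfl | hj
  · exact (abs_of_nonneg hp0).le
  have hcoeff : ∀ k ≠ e, (G.proj (G.edgeChain e)).coeff k =
      (f (G.head k) - f (G.tail k)) / G.len k := fun k hk => by
    rw [G.coeff_proj_edgeChain e hf, if_neg hk, zero_add]
  rcases eq_or_ne (f (G.head j)) (f (G.tail j)) with heq | hne
  · rw [hcoeff j hj, heq, sub_self, zero_div, abs_zero]
    exact hp0
  -- a superlevel set of the potential is a cut separating the endpoints of `j`
  set c := max (f (G.head j)) (f (G.tail j)) with hc
  set g : V → ℝ := fun x => if c ≤ f x then 1 else 0 with hg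
  set p := G.proj (G.edgeChain e) with hpdef
  have hsum := G.sum_sub_mul_coeff_proj (G.edgeChain e) g
  rw [← hpdef, ← Finset.add_sum_erase _ _ (Finset.mem_univ e)] at hsum
  -- `g` is a nondecreasing function of `f`, so its increment along `k` never has the sign opposite
  -- to that of `f`.
  have hterm : ∀ k ≠ e, 0 ≤ (g (G.head k) - g (G.tail k)) * p.coeff k := by
    intro k hk
    rw [hcoeff k hk, ← mul_div_assoc]
    refine div_nonneg ?_ (G.len_pos k).le
    simp only [hg]
    split_ifs <;> linarith
  have hle := Finset.single_le_sum (f := fun k => (g (G.head k) - g (G.tail k)) * p.coeff k)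
    (fun k hk => hterm k (Finset.ne_of_mem_erase hk))
    (Finset.mem_erase.2 ⟨hj, Finset.mem_univ j⟩)
  -- The threshold `c` is the larger of two distinct endpoint values, so exactly one endpoint of `j`
  -- lies in the superlevel set.
  have hjabs : (g (G.head j) - g (G.tail j)) * p.coeff j = |p.coeff j| := by
    have hl := G.len_pos j
    rw [hcoeff j hj]
    rcases lt_or_gt_of_ne hne with hlt | hlt
    · have h1 : g (G.head j) = 0 := if_neg (by rw [hc, max_eq_right hlt.le]; exact hlt.not_ge)
      have h2 : g (G.tail j) = 1 := if_pos (by rw [hc, max_eq_right hlt.le])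
      rw [h1, h2, abs_of_nonpos (div_nonpos_of_nonpos_of_nonneg (by linarith) hl.le)]
      ring
    · have h1 : g (G.head j) = 1 := if_pos (by rw [hc, max_eq_left hlt.le])
      have h2 : g (G.tail j) = 0 := if_neg (by rw [hc, max_eq_left hlt.le]; exact hlt.not_ge)
      rw [h1, h2, abs_of_nonneg (div_nonneg (by linarith) hl.le)]
      ring
  -- The increment of `g` along `e` is `-1`, `0` or `1`, and `p.coeff e` is nonnegative.
  have he : -((g (G.head e) - g (G.tail e)) * p.coeff e) ≤ p.coeff e := by
    simp only [hg]
    split_ifs <;> linarith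
  simp only [hjabs] at hle
  linarith

theorem foster_eq_coeff {V E : Type*} [Fintype V] [Fintype E] [DecidableEq V] [DecidableEq E]
    (G : LengthGraph V E) (hG : G.Connected) (e : E) :
    G.foster e = (G.proj (G.edgeChain e)).coeff e := by
  have : Nonempty E := ⟨e⟩
  refine le_antisymm (ciSup_le fun j => G.abs_coeff_proj_edgeChain_le hG e j) ?_
  exact (le_abs_self _).trans
    (le_ciSup (f := fun j => |(G.proj (G.edgeChain e)).coeff j|) (Set.finite_range _).bddAbove e)

theorem foster_eq_one_sub {V E : Type*} [Fintype V] [Fintype E] [DecidableEq V] [DecidableEq E]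
    (G : LengthGraph V E) (hG : G.Connected) (e : E) :
    G.foster e = 1 - G.edgeRes e / G.len e := by
  obtain ⟨f, hf⟩ := G.exists_isPotential hG (G.tail e) (G.head e)
  rw [G.foster_eq_coeff hG, G.coeff_proj_edgeChain e hf, if_pos rfl, edgeRes, G.effRes_eq hG hf]
  ring

/-! ### Deletion of the edge -/

/-- Restoring `e` changes the balance of currents only at its endpoints, by the current that `e`
carries. -/
theorem laplacian_deleteEdge {V E : Type*} [Fintype E] [DecidableEq V] [DecidableEq E]
    (G : LengthGraph V E) (e : E) (f : V → ℝ) :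
    G.laplacian f = (G.deleteEdge e).laplacian f +
      ((f (G.head e) - f (G.tail e)) / G.len e) •
        (Pi.single (G.head e) 1 - Pi.single (G.tail e) 1) := by
  have key (p : E → V) (x : V) : ∑ k with p k = x, (G.d f).coeff k =
      ∑ k with p (Subtype.val k) = x, ((G.deleteEdge e).d f).coeff k +
        (f (G.head e) - f (G.tail e)) / G.len e * (Pi.single (p e) 1 : V → ℝ) x := by
    rw [Finset.sum_filter, Finset.sum_filter, Fintype.sum_eq_add_sum_subtype_ne _ e, add_comm]
    congr 1
    simp [d_apply, Pi.single_apply, eq_comm]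
  funext x
  change G.dStar (G.d f) x = (G.deleteEdge e).dStar ((G.deleteEdge e).d f) x + _
  rw [dStar_apply, dStar_apply, key, key, Pi.smul_apply, Pi.sub_apply, smul_eq_mul]
  change _ = (∑ k with G.head (Subtype.val k) = x, ((G.deleteEdge e).d f).coeff k) -
    ∑ k with G.tail (Subtype.val k) = x, ((G.deleteEdge e).d f).coeff k + _
  ring

/-- The potential drop is the dissipated energy: `f x - f y = ⟨f, Δ f⟩ = ‖d f‖²`. Applied to `G -
e`, it keeps `ℓ(e) + 𝓡(e)` positive. -/
theorem IsPotential.le {V : Type*} [Fintype V] [DecidableEq V] {F : Type*} [Fintype F]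
    {G : LengthGraph V F} {x y : V} {f : V → ℝ}
    (hf : G.IsPotential x y f) : f y ≤ f x := by
  have h := G.inner_d f (G.d f)
  have h' : G.dStar (G.d f) = Pi.single x 1 - Pi.single y 1 := hf
  have h0 : 0 ≤ inner ℝ (G.d f) (G.d f) := real_inner_self_nonneg
  rw [h, h'] at h0
  simp only [Pi.sub_apply, mul_sub, Finset.sum_sub_distrib, Pi.single_apply, mul_ite, mul_one,
    mul_zero, Finset.sum_ite_eq', Finset.mem_univ, if_true] at h0
  linarith

theorem foster_eq_of_connected_deleteEdge {V E : Type*}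
    [Fintype V] [Fintype E] [DecidableEq V] [DecidableEq E]
    (G : LengthGraph V E) (hG : G.Connected) (e : E)
    (he : (G.deleteEdge e).Connected) :
    G.foster e = G.len e / (G.len e + (G.deleteEdge e).effRes (G.tail e) (G.head e)) := by
  obtain ⟨f, hf⟩ := (G.deleteEdge e).exists_isPotential he (G.tail e) (G.head e)
  rw [effRes_eq _ he hf]
  have hle := hf.le
  have hl := G.len_pos e
  have hpos : 0 < G.len e + (f (G.tail e) - f (G.head e)) := by linarith
  -- With `R` the drop of `f`, restoring `e` adds a current `R / ℓ(e)` to the unit current of `G -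
  -- e`. Dividing by the total `1 + R / ℓ(e)` makes it a unit current again.
  have hpot : G.IsPotential (G.tail e) (G.head e)
      ((G.len e / (G.len e + (f (G.tail e) - f (G.head e)))) • f) := by
    have hf' : (G.deleteEdge e).laplacian f = _ := hf
    rw [IsPotential, map_smul, G.laplacian_deleteEdge e, hf']
    funext x
    simp only [Pi.smul_apply, Pi.add_apply, Pi.sub_apply, smul_eq_mul]
    field_simp
    ring
  rw [G.foster_eq_one_sub hG, edgeRes, G.effRes_eq hG hpot]
  simp only [Pi.smul_apply, smul_eq_mul]
  field_simp
  ring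

theorem Adj.symm {V E : Type*} {G : LengthGraph V E} {x y : V} (h : G.Adj x y) : G.Adj y x := by
  obtain ⟨k, hk⟩ := h
  exact ⟨k, hk.symm⟩

/-- Deleting an edge whose endpoints stay joined by a path preserves connectedness. -/
theorem Connected.deleteEdge {V E : Type*} {G : LengthGraph V E} (hG : G.Connected) {e : E}
    (h : Relation.ReflTransGen (G.deleteEdge e).Adj (G.tail e) (G.head e)) :
    (G.deleteEdge e).Connected := by
  have hsymm : Relation.ReflTransGen (G.deleteEdge e).Adj (G.head e) (G.tail e) := by
    have : Std.Symm (G.deleteEdge e).Adj := ⟨fun _ _ => Adj.symm⟩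
    exact Std.Symm.symm _ _ h
  refine ⟨hG.1, fun x y => ?_⟩
  induction hG.2 x y with
  | refl => exact .refl
  | tail _ hbc ih =>
    refine ih.trans ?_
    obtain ⟨k, hk⟩ := hbc
    by_cases hke : k = e
    · subst hke
      obtain ⟨rfl, rfl⟩ | ⟨rfl, rfl⟩ := hk
      exacts [h, hsymm]
    · exact .single ⟨⟨k, hke⟩, hk⟩

theorem foster_eq_zero_of_not_connected_deleteEdge {V E : Type*}
    [Fintype V] [Fintype E] [DecidableEq V] [DecidableEq E]
    (G : LengthGraph V E) (hG : G.Connected)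
    (e : E) (he : ¬ (G.deleteEdge e).Connected) : G.foster e = 0 := by
  classical
  -- `S` is the component of `e⁻` in `G - e`. Only `e` crosses its boundary, so the cycle `π(e)`
  -- must vanish on `e`.
  set S : Set V := {x | Relation.ReflTransGen (G.deleteEdge e).Adj (G.tail e) x}
  have ht : G.tail e ∈ S := .refl
  have hh : G.head e ∉ S := fun h => he (hG.deleteEdge h)
  have hS : ∀ k ≠ e, (G.head k ∈ S ↔ G.tail k ∈ S) := fun k hk =>
    ⟨fun h => h.tail ⟨⟨k, hk⟩, .inr ⟨rfl, rfl⟩⟩, fun h => h.tail ⟨⟨k, hk⟩, .inl ⟨rfl, rfl⟩⟩⟩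
  have hsum := G.sum_sub_mul_coeff_proj (G.edgeChain e) fun x => if x ∈ S then 1 else 0
  rw [Finset.sum_eq_single_of_mem e (Finset.mem_univ e)
    fun k _ hk => by simp [hS k hk]] at hsum
  simp only [ht, hh, if_true, if_false] at hsum
  rw [G.foster_eq_coeff hG]
  linarith

end LengthGraph

theorem mainTheorem8 {V E : Type*} [Fintype V] [Fintype E] [DecidableEq V] [DecidableEq E]
    (G : LengthGraph V E) (hG : G.Connected) (e : E) :
    G.foster e = 1 - G.edgeRes e / G.len e ∧
      (G.foster e : EReal) = (G.len e : EReal) / ((G.len e : EReal) + G.edgeDelRes e) := by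
  refine ⟨G.foster_eq_one_sub hG e, ?_⟩
  rw [LengthGraph.edgeDelRes]
  split_ifs with he
  · rw [G.foster_eq_of_connected_deleteEdge hG e he, ← EReal.coe_add, EReal.coe_div]
  -- Division by `⊤` in `EReal` gives `0`, which is the stated convention for `𝓡(e) = ∞`.
  · rw [G.foster_eq_zero_of_not_connected_deleteEdge hG e he, EReal.coe_add_top, EReal.div_top,
      EReal.coe_zero]
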